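/- Let $e_{-1,0}(t)=t$, $e_{0,0}(t)=(\min\{t,1-t\})^+$ and $e_{m,k}(t)=2^{-m/2}e_{0,0}(2^mt-k)$ be the Faber--Schauder functions, where $m\ge 0$ and $0\le k\le 2^m-1$. For $F\in C^1[0,1]$ with derivative $f=F'$, the Faber--Schauder coefficients of $f$ are $\theta_{-1,0}=f(1)-f(0)$ and $$\theta_{m,k}=2^{m/2}\Big(2f\big(\tfrac{2k+1}{2^{m+1}}\big)-f\big(\tfrac{k}{2^m}\big)-f\big(\tfrac{k+1}{2^m}\big)\Big),\qquad m\ge 0,\ 0\le k\le 2^m-1 .$$ For $n\in\mathbb N$, the estimated coefficients $\vartheta^{(n)}_{-1,0}$ and $\vartheta^{(n)}_{m,k}$ ($0\le m\le n$, $0\le k\le 2^m-1$) are those for which the function $$\hat f_n=f(0)+\vartheta^{(n)}_{-1,0}e_{-1,0}+\sum_{m=0}^{n}\sum_{k=0}^{2^m-1}\vartheta^{(n)}_{m,k}e_{m,k}$$ satisfies $F(0)+\int_0^t\hat f_n(s)\,ds=F(t)$ for all $t\in\{j2^{-n-1}: j=0,\dots,2^{n+1}\}$. Then for all $n\ge 2$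 and $\varepsilon>0$ there exists $F\in C^1[0,1]$ for which the coefficients $\vartheta^{(n)}_{m,k}$ exist and are unique, the error of the coefficients up to generation $n-1$ is nonzero, $$E_{n-1}:=\Big((\vartheta^{(n)}_{-1,0}-\theta_{-1,0})^2+\sum_{m=0}^{n-1}\sum_{k=0}^{2^m-1}(\vartheta^{(n)}_{m,k}-\theta_{m,k})^2\Big)^{1/2}>0,$$ and the error of the coefficients of the final generation $n$ satisfies $$\Big(\sum_{k=0}^{2^n-1}(\vartheta^{(n)}_{n,k}-\theta_{n,k})^2\Big)^{1/2}\ \ge\ 2(1-\varepsilon)\sqrt{\frac{2^{2n+2}}{\pi^2}-\frac34}\;E_{n-1}.$$ -/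

import Mathlib

open Set

noncomputable section

/-- The tent function `e₀,₀(t) = (min {t, 1 - t})⁺`. -/
def tent (t : ℝ) : ℝ := max (min t (1 - t)) 0

/-- The index set of the Faber-Schauder functions of all generations `-1, 0, …, N - 1`.
The index `none` stands for `(-1, 0)`, and `some ⟨m, k⟩` for `(m, k)` with `0 ≤ m ≤ N - 1` and
`0 ≤ k ≤ 2 ^ m - 1`. There are `2 ^ N` indices. -/
abbrev FSIndex (N : ℕ) : Type := Option ((m : Fin N) × Fin (2 ^ (m : ℕ)))

/-- The Faber-Schauder functions: `e₋₁,₀(t) = t` and `e_{m,k}(t) = 2^{-m/2} e₀,₀(2^m t - k)`. -/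
def faberSchauder {N : ℕ} : FSIndex N → ℝ → ℝ
  | none, t => t
  | some ⟨m, k⟩, t => (2 : ℝ) ^ (-((m : ℕ) : ℝ) / 2) * tent (2 ^ (m : ℕ) * t - ((k : ℕ) : ℝ))

/-- The Faber-Schauder coefficients of a function `f` on `[0, 1]`, up to generation `N - 1`:
`θ₋₁,₀ = f(1) - f(0)` and
`θ_{m,k} = 2^{m/2} (2 f((2k+1)/2^{m+1}) - f(k/2^m) - f((k+1)/2^m))`. -/
def faberSchauderCoeff (N : ℕ) (f : ℝ → ℝ) : FSIndex N → ℝ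
  | none => f 1 - f 0
  | some ⟨m, k⟩ => (2 : ℝ) ^ (((m : ℕ) : ℝ) / 2) *
      (2 * f ((2 * ((k : ℕ) : ℝ) + 1) / 2 ^ ((m : ℕ) + 1))
        - f (((k : ℕ) : ℝ) / 2 ^ (m : ℕ)) - f ((((k : ℕ) : ℝ) + 1) / 2 ^ (m : ℕ)))

/-- The function with initial value `f₀` and Faber-Schauder coefficients `ϑ`:
`f₀ + ϑ₋₁,₀ e₋₁,₀ + ∑ₘ ∑ₖ ϑ_{m,k} e_{m,k}`. -/
def faberSchauderSum {N : ℕ} (f₀ : ℝ) (ϑ : FSIndex N → ℝ) (t : ℝ) : ℝ :=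
  f₀ + ∑ i, ϑ i * faberSchauder i t

/-- `ϑ` solves the quadratic spline interpolation problem for `F` with initial value `f₀`: the
antiderivative `F(0) + ∫₀ᵗ f̂ₙ(s) ds` of the function `f̂ₙ` with initial value `f₀` and
Faber-Schauder coefficients `ϑ` up to generation `n` agrees with `F` at all points
`t = j / 2^{n+1}`, `j = 0, …, 2^{n+1}`. -/
def SolvesInterpolation (n : ℕ) (F : ℝ → ℝ) (f₀ : ℝ) (ϑ : FSIndex (n + 1) → ℝ) : Prop :=
  ∀ j : ℕ, j ≤ 2 ^ (n + 1) →
    F 0 + ∫ s in (0 : ℝ)..((j : ℝ) / 2 ^ (n + 1)), faberSchauderSum f₀ ϑ s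
      = F ((j : ℝ) / 2 ^ (n + 1))

/-- The inclusion of the indices of the generations `-1, …, n - 1` into those of the generations
`-1, …, n`. -/
def FSIndex.lift {n : ℕ} : FSIndex n → FSIndex (n + 1)
  | none => none
  | some ⟨m, k⟩ => some ⟨m.castSucc, k⟩

/-- From a vector of coefficients up to generation `n`, the subvector of the coefficients of the
generations `-1, …, n - 1`, as an element of `ℓ₂`. -/
def previousGenerations {n : ℕ} (x : FSIndex (n + 1) → ℝ) : EuclideanSpace ℝ (FSIndex n) :=
  WithLp.toLp 2 fun i => x i.lift

/-- From a vector of coefficients up to generation `n`, the subvector of the coefficients of the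
final generation `n`, as an element of `ℓ₂`. -/
def finalGeneration {n : ℕ} (x : FSIndex (n + 1) → ℝ) : EuclideanSpace ℝ (Fin (2 ^ n)) :=
  WithLp.toLp 2 fun k => x (some ⟨Fin.last n, k⟩)

end

/-! The interpolation problem sees `F` only at the grid points `j / 2 ^ (n + 1)` (and `f 0`), while
the true coefficients see `f = F'` only at the same points. For a `C¹` function these two sets of
data are independent, so the error vector can be prescribed at will. Given `w`, let `G` be the
antiderivative of the Faber–Schauder sum with coefficients `w`, and put `F = G ∘ φ`, where `φ` fixes
every grid point and has derivative zero there. Then `F = G` on the grid, so `w` solves the problem,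
while `f` vanishes on the grid, so its true coefficients are zero: the error is exactly `w`
(`exists_interpolation_error_eq`). Hence no constant bounds the final generation by the earlier
ones; the stated constant is just one instance. Uniqueness comes from the trapezoidal rule on each
cell, which determines the grid values recursively from `f₀`, together with the recovery of the
coefficients from the grid values. -/

theorem continuous_tent : Continuous tent := by
  unfold tent; fun_prop

theorem tent_intCast (a : ℤ) : tent a = 0 := by
  unfold tent
  rcases le_or_gt a 0 with h | h
  · have : (a : ℝ) ≤ 0 := by exact_mod_cast h
    exact max_eq_right ((min_le_left _ _).trans this)
  · have : (1 : ℝ) ≤ a := by exact_mod_cast h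
    exact max_eq_right ((min_le_right _ _).trans (by linarith))

theorem tent_of_nonpos {x : ℝ} (h : x ≤ 0) : tent x = 0 :=
  max_eq_right ((min_le_left _ _).trans h)

theorem tent_of_one_le {x : ℝ} (h : 1 ≤ x) : tent x = 0 :=
  max_eq_right ((min_le_right _ _).trans (by linarith))

theorem tent_half : tent (1 / 2) = 1 / 2 := by
  unfold tent; norm_num

/-- The tent function is affine between two consecutive half-integers. -/
theorem exists_affine_tent (a : ℤ) :
    ∃ α β : ℝ, ∀ x : ℝ, (a : ℝ) ≤ 2 * x → 2 * x ≤ a + 1 → tent x = α * x + β := by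
  rcases lt_trichotomy a 0 with h | rfl | h
  · refine ⟨0, 0, fun x _ h₂ => ?_⟩
    have : (a : ℝ) + 1 ≤ 0 := by exact_mod_cast h
    rw [tent_of_nonpos (by linarith)]; ring
  · refine ⟨1, 0, fun x h₁ h₂ => ?_⟩
    push_cast at h₁ h₂
    rw [tent, min_eq_left (by linarith), max_eq_left (by linarith)]; ring
  · rcases eq_or_ne a 1 with rfl | h'
    · refine ⟨-1, 1, fun x h₁ h₂ => ?_⟩
      push_cast at h₁ h₂
      rw [tent, min_eq_right (by linarith), max_eq_left (by linarith)]; ring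
    · refine ⟨0, 0, fun x h₁ _ => ?_⟩
      have : (2 : ℝ) ≤ a := by exact_mod_cast (show (2 : ℤ) ≤ a by omega)
      rw [tent_of_one_le (by linarith)]; ring

/-- A scaled tent function of generation `m < M` is affine on the dyadic intervals of
length `2 ^ (-M)`. -/
theorem exists_affine_tent_dyadic {m M : ℕ} (h : m < M) (j k : ℕ) :
    ∃ α β : ℝ, ∀ t ∈ Icc ((j : ℝ) / 2 ^ M) (((j : ℝ) + 1) / 2 ^ M),
      tent (2 ^ m * t - k) = α * t + β := by
  obtain ⟨d, rfl⟩ := Nat.exists_eq_add_of_lt h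
  -- The cell of length `2 ^ (-M)` lies in the cell of length `2 ^ (-(m + 1))` with index `⌊j / 2 ^
  -- d⌋`, since `M = m + d + 1`.
  obtain ⟨α, β, hαβ⟩ := exists_affine_tent (((j / 2 ^ d : ℕ) : ℤ) - 2 * k)
  refine ⟨α * 2 ^ m, β - α * k, fun t ⟨h₁, h₂⟩ => ?_⟩
  have hd : (0 : ℝ) < 2 ^ d := by positivity
  rw [div_le_iff₀ (by positivity)] at h₁
  rw [le_div_iff₀ (by positivity)] at h₂
  have e : t * 2 ^ (m + d + 1) = (2 * (2 ^ m * t)) * 2 ^ d := by ring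
  rw [e] at h₁ h₂
  have lo : ((j / 2 ^ d : ℕ) : ℝ) * 2 ^ d ≤ j := by exact_mod_cast Nat.div_mul_le_self j (2 ^ d)
  have hi : (j : ℝ) + 1 ≤ (((j / 2 ^ d : ℕ) : ℝ) + 1) * 2 ^ d := by
    exact_mod_cast Nat.lt_succ_iff.mp (Nat.lt_succ_of_le (Nat.succ_le_of_lt
      (Nat.lt_mul_of_div_lt (Nat.lt_succ_self (j / 2 ^ d)) (by positivity))))
  have h₃ := le_of_mul_le_mul_right (lo.trans h₁) hd
  have h₄ := le_of_mul_le_mul_right (h₂.trans hi) hd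
  generalize j / 2 ^ d = q at *
  rw [hαβ]
  · ring
  · push_cast at h₃ ⊢; linarith
  · push_cast at h₄ ⊢; linarith

/-! ### Faber–Schauder functions: piecewise linearity and biorthogonality -/

theorem continuous_faberSchauder {N : ℕ} (i : FSIndex N) : Continuous (faberSchauder i) := by
  rcases i with _ | ⟨m, k⟩
  · exact continuous_id
  · exact continuous_const.mul (continuous_tent.comp (by fun_prop))

theorem continuous_faberSchauderSum {N : ℕ} (f₀ : ℝ) (ϑ : FSIndex N → ℝ) :
    Continuous (faberSchauderSum f₀ ϑ) :=
  continuous_const.add (continuous_finsetSum _ fun i _ =>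
    continuous_const.mul (continuous_faberSchauder i))

theorem faberSchauder_zero {N : ℕ} (i : FSIndex N) : faberSchauder i 0 = 0 := by
  rcases i with _ | ⟨m, k⟩
  · rfl
  · simp only [faberSchauder]
    rw [tent_of_nonpos (by simp), mul_zero]

theorem exists_affine_faberSchauder {N : ℕ} (i : FSIndex N) (j : ℕ) :
    ∃ α β : ℝ, ∀ t ∈ Icc ((j : ℝ) / 2 ^ N) (((j : ℝ) + 1) / 2 ^ N),
      faberSchauder i t = α * t + β := by
  rcases i with _ | ⟨m, k⟩
  · exact ⟨1, 0, fun t _ => by simp [faberSchauder]⟩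
  · obtain ⟨α, β, h⟩ := exists_affine_tent_dyadic m.2 j k
    refine ⟨2 ^ (-((m : ℕ) : ℝ) / 2) * α, 2 ^ (-((m : ℕ) : ℝ) / 2) * β, fun t ht => ?_⟩
    simp only [faberSchauder]
    rw [h t ht]; ring

/-- The trapezoidal rule is exact for Faber-Schauder sums on the cells of the finest grid. -/
theorem integral_faberSchauderSum_cell {N : ℕ} (f₀ : ℝ) (ϑ : FSIndex N → ℝ) (j : ℕ) :
    ∫ s in ((j : ℝ) / 2 ^ N)..(((j : ℝ) + 1) / 2 ^ N), faberSchauderSum f₀ ϑ s =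
      (faberSchauderSum f₀ ϑ ((j : ℝ) / 2 ^ N) +
        faberSchauderSum f₀ ϑ (((j : ℝ) + 1) / 2 ^ N)) / (2 * 2 ^ N) := by
  choose α β h using fun i : FSIndex N => exists_affine_faberSchauder i j
  have hle : (j : ℝ) / 2 ^ N ≤ ((j : ℝ) + 1) / 2 ^ N := by gcongr; linarith
  have key : ∀ t ∈ Icc ((j : ℝ) / 2 ^ N) (((j : ℝ) + 1) / 2 ^ N),
      faberSchauderSum f₀ ϑ t = (∑ i, ϑ i * α i) * t + (f₀ + ∑ i, ϑ i * β i) := by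
    intro t ht
    rw [faberSchauderSum, Finset.sum_congr rfl fun i _ => by rw [h i t ht], Finset.sum_mul,
      add_left_comm, ← Finset.sum_add_distrib]
    congr 1
    exact Finset.sum_congr rfl fun i _ => by ring
  rw [intervalIntegral.integral_congr (g := fun t => (∑ i, ϑ i * α i) * t +
    (f₀ + ∑ i, ϑ i * β i)) (fun t ht => key t (by rwa [uIcc_of_le hle] at ht)),
    key _ (left_mem_Icc.2 hle), key _ (right_mem_Icc.2 hle),
    intervalIntegral.integral_add (by apply Continuous.intervalIntegrable; fun_prop) (by simp),
    intervalIntegral.integral_const_mul, integral_id, intervalIntegral.integral_const, smul_eq_mul]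
  field_simp
  ring

/-- A coefficient of generation `m` is a scaled second difference over a dyadic interval. It kills
coarser functions, which are affine there, and finer ones, which vanish at all three nodes; within
generation `m` the supports overlap only at endpoints. -/
theorem faberSchauderCoeff_faberSchauder {N : ℕ} (i i' : FSIndex N) :
    faberSchauderCoeff N (faberSchauder i') i = if i' = i then 1 else 0 := by
  rcases i with _ | ⟨m, k⟩ <;> rcases i' with _ | ⟨m', k'⟩
  · simp [faberSchauderCoeff, faberSchauder]
  · have h : (2 : ℝ) ^ (m' : ℕ) * 1 - (k' : ℕ) = (((2 ^ (m' : ℕ) : ℤ) - (k' : ℕ) : ℤ) : ℝ) := by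
      push_cast; ring
    simp only [faberSchauderCoeff, faberSchauder_zero]
    simp only [faberSchauder, h, tent_intCast]
    simp
  · simp only [faberSchauderCoeff, faberSchauder, reduceCtorEq, if_false]
    field_simp
    ring
  · rcases lt_trichotomy (m' : ℕ) m with h | h | h
    · obtain ⟨α, β, hαβ⟩ := exists_affine_tent_dyadic h k k'
      have hne : (some ⟨m', k'⟩ : FSIndex N) ≠ some ⟨m, k⟩ := by
        rintro ⟨⟩; exact lt_irrefl _ h
      rw [if_neg hne]
      have h₁ : ((k : ℕ) : ℝ) / 2 ^ (m : ℕ) ≤ (((k : ℕ) : ℝ) + 1) / 2 ^ (m : ℕ) := by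
        gcongr; linarith
      have e : (2 * ((k : ℕ) : ℝ) + 1) / 2 ^ ((m : ℕ) + 1) =
          (((k : ℕ) : ℝ) / 2 ^ (m : ℕ) + (((k : ℕ) : ℝ) + 1) / 2 ^ (m : ℕ)) / 2 := by
        field_simp; ring
      simp only [faberSchauderCoeff, faberSchauder]
      rw [hαβ _ (left_mem_Icc.2 h₁), hαβ _ (right_mem_Icc.2 h₁), hαβ, e]
      · ring
      · rw [e]; constructor <;> linarith
    · obtain rfl : m' = m := Fin.ext h
      have e₁ : (2 : ℝ) ^ (m' : ℕ) * (((k : ℕ) : ℝ) / 2 ^ (m' : ℕ)) - ((k' : ℕ) : ℝ) =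
          (((k : ℕ) - (k' : ℕ) : ℤ) : ℝ) := by push_cast; field_simp
      have e₂ : (2 : ℝ) ^ (m' : ℕ) * ((((k : ℕ) : ℝ) + 1) / 2 ^ (m' : ℕ)) - ((k' : ℕ) : ℝ) =
          (((k : ℕ) + 1 - (k' : ℕ) : ℤ) : ℝ) := by push_cast; field_simp
      have e₃ : (2 : ℝ) ^ (m' : ℕ) * ((2 * ((k : ℕ) : ℝ) + 1) / 2 ^ ((m' : ℕ) + 1)) -
          ((k' : ℕ) : ℝ) = ((k : ℕ) : ℝ) - ((k' : ℕ) : ℝ) + 1 / 2 := by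
        field_simp; ring
      simp only [faberSchauderCoeff, faberSchauder, e₁, e₂, e₃, tent_intCast]
      have hp : (2 : ℝ) ^ (((m' : ℕ) : ℝ) / 2) * 2 ^ (-((m' : ℕ) : ℝ) / 2) = 1 := by
        rw [← Real.rpow_add two_pos]; ring_nf; exact Real.rpow_zero _
      rcases lt_trichotomy (k' : ℕ) k with hk | hk | hk
      · have hne : (some ⟨m', k'⟩ : FSIndex N) ≠ some ⟨m', k⟩ := by
          rintro ⟨⟩; exact lt_irrefl _ hk
        have : ((k' : ℕ) : ℝ) + 1 ≤ (k : ℕ) := by exact_mod_cast hk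
        rw [if_neg hne, tent_of_one_le (by linarith)]; ring
      · obtain rfl : k' = k := Fin.ext hk
        rw [if_pos rfl, sub_self, zero_add, tent_half]
        linear_combination hp
      · have hne : (some ⟨m', k'⟩ : FSIndex N) ≠ some ⟨m', k⟩ := by
          rintro ⟨⟩; exact lt_irrefl _ hk
        have : ((k : ℕ) : ℝ) + 1 ≤ (k' : ℕ) := by exact_mod_cast hk
        rw [if_neg hne, tent_of_nonpos (by linarith)]; ring
    · have hne : (some ⟨m', k'⟩ : FSIndex N) ≠ some ⟨m, k⟩ := by
        rintro ⟨⟩; exact lt_irrefl _ h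
      obtain ⟨d, hd⟩ := Nat.exists_eq_add_of_lt h
      have hpow : (2 : ℝ) ^ (m' : ℕ) = 2 ^ (m : ℕ) * 2 ^ (d + 1) := by
        rw [← pow_add, ← add_assoc, ← hd]
      have e₁ : (2 : ℝ) ^ (m' : ℕ) * (((k : ℕ) : ℝ) / 2 ^ (m : ℕ)) - ((k' : ℕ) : ℝ) =
          (((k : ℕ) * 2 ^ (d + 1) - (k' : ℕ) : ℤ) : ℝ) := by
        rw [hpow]; push_cast; field_simp
      have e₂ : (2 : ℝ) ^ (m' : ℕ) * ((((k : ℕ) : ℝ) + 1) / 2 ^ (m : ℕ)) - ((k' : ℕ) : ℝ) =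
          ((((k : ℕ) + 1) * 2 ^ (d + 1) - (k' : ℕ) : ℤ) : ℝ) := by
        rw [hpow]; push_cast; field_simp
      have e₃ : (2 : ℝ) ^ (m' : ℕ) * ((2 * ((k : ℕ) : ℝ) + 1) / 2 ^ ((m : ℕ) + 1)) -
          ((k' : ℕ) : ℝ) = (((2 * (k : ℕ) + 1) * 2 ^ d - (k' : ℕ) : ℤ) : ℝ) := by
        rw [hpow]; push_cast; field_simp; ring
      simp only [faberSchauderCoeff, faberSchauder, e₁, e₂, e₃, tent_intCast, if_neg hne]
      ring

/-- The Faber-Schauder coefficients of a Faber-Schauder sum are the ones it is built from. -/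
theorem faberSchauderCoeff_faberSchauderSum {N : ℕ} (f₀ : ℝ) (ϑ : FSIndex N → ℝ) :
    faberSchauderCoeff N (faberSchauderSum f₀ ϑ) = ϑ := by
  funext i
  have h : faberSchauderCoeff N (faberSchauderSum f₀ ϑ) i =
      ∑ i', ϑ i' * faberSchauderCoeff N (faberSchauder i') i := by
    rcases i with _ | ⟨m, k⟩
    · simp only [faberSchauderCoeff, faberSchauderSum, mul_sub, Finset.sum_sub_distrib]
      ring
    · simp only [faberSchauderCoeff, faberSchauderSum, mul_sub, Finset.sum_sub_distrib,
        mul_left_comm (ϑ _), ← Finset.mul_sum]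
      ring
  rw [h]
  simp [faberSchauderCoeff_faberSchauder]

/-- The Faber-Schauder coefficients up to generation `N - 1` depend only on the values on the grid
of mesh `2 ^ (-N)`. -/
theorem faberSchauderCoeff_congr {N : ℕ} {f g : ℝ → ℝ}
    (h : ∀ j : ℕ, j ≤ 2 ^ N → f ((j : ℝ) / 2 ^ N) = g ((j : ℝ) / 2 ^ N)) :
    faberSchauderCoeff N f = faberSchauderCoeff N g := by
  have h' : ∀ M ≤ N, ∀ j : ℕ, j ≤ 2 ^ M → f ((j : ℝ) / 2 ^ M) = g ((j : ℝ) / 2 ^ M) := by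
    intro M hM j hj
    obtain ⟨d, rfl⟩ := Nat.exists_eq_add_of_le hM
    have e : (j : ℝ) / 2 ^ M = ((j * 2 ^ d : ℕ) : ℝ) / 2 ^ (M + d) := by
      push_cast; field_simp; ring
    rw [e]
    exact h _ (by rw [pow_add]; gcongr)
  funext i
  rcases i with _ | ⟨m, k⟩
  · have h₀ := h' 0 (Nat.zero_le _) 0 (by simp)
    have h₁ := h' 0 (Nat.zero_le _) 1 (by simp)
    simp only [Nat.cast_zero, Nat.cast_one, pow_zero, div_one] at h₀ h₁
    simp only [faberSchauderCoeff, h₀, h₁]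
  · have hk := k.2
    have h₀ := h' m m.2.le k k.2.le
    have h₁ := h' m m.2.le (k + 1) k.2
    have h₂ := h' (m + 1) m.2 (2 * k + 1) (by rw [pow_succ]; omega)
    push_cast at h₀ h₁ h₂
    simp only [faberSchauderCoeff, h₀, h₁, h₂]

theorem faberSchauderSum_apply_zero {N : ℕ} (f₀ : ℝ) (ϑ : FSIndex N → ℝ) :
    faberSchauderSum f₀ ϑ 0 = f₀ := by
  simp [faberSchauderSum, faberSchauder_zero]

/-- A solution of the interpolation problem is unique. -/
theorem SolvesInterpolation.unique {n : ℕ} {F : ℝ → ℝ} {f₀ : ℝ} {ϑ ϑ' : FSIndex (n + 1) → ℝ}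
    (h : SolvesInterpolation n F f₀ ϑ) (h' : SolvesInterpolation n F f₀ ϑ') : ϑ' = ϑ := by
  rw [← faberSchauderCoeff_faberSchauderSum f₀ ϑ, ← faberSchauderCoeff_faberSchauderSum f₀ ϑ']
  refine faberSchauderCoeff_congr fun j => ?_
  -- The increments of `F` fix the sum of any two neighbouring grid values, so each value determines
  -- the next.
  have cell : ∀ ψ : FSIndex (n + 1) → ℝ, SolvesInterpolation n F f₀ ψ → ∀ j : ℕ, j < 2 ^ (n + 1) →
      faberSchauderSum f₀ ψ ((j : ℝ) / 2 ^ (n + 1)) +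
        faberSchauderSum f₀ ψ (((j : ℝ) + 1) / 2 ^ (n + 1)) =
      (F (((j : ℝ) + 1) / 2 ^ (n + 1)) - F ((j : ℝ) / 2 ^ (n + 1))) * (2 * 2 ^ (n + 1)) := by
    intro ψ hψ j hj
    have h₀ := hψ j hj.le
    have h₁ := hψ (j + 1) hj
    push_cast at h₁
    have hi : ∀ a b, IntervalIntegrable (faberSchauderSum f₀ ψ) MeasureTheory.volume a b :=
      fun a b => (continuous_faberSchauderSum f₀ ψ).intervalIntegrable a b
    rw [← h₀, ← h₁, add_sub_add_left_eq_sub, intervalIntegral.integral_interval_sub_left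
      (hi _ _) (hi _ _), integral_faberSchauderSum_cell]
    field_simp
  induction j with
  | zero => intro _; simp [faberSchauderSum_apply_zero]
  | succ j ih =>
    intro hj
    have e₁ := cell ϑ h j hj
    have e₂ := cell ϑ' h' j hj
    have e₃ := ih (Nat.le_of_succ_le hj)
    push_cast
    linarith

/-- Every vector is the error of the interpolation problem for some continuously differentiable
function. The function is the antiderivative of the Faber-Schauder sum of the vector, precomposed
with a map that fixes the grid points and is stationary there. -/
theorem exists_interpolation_error_eq (n : ℕ) (w : FSIndex (n + 1) → ℝ) :
    ∃ F f : ℝ → ℝ, Continuous f ∧ (∀ t, HasDerivAt F (f t) t) ∧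
      ∃ ϑ : FSIndex (n + 1) → ℝ, SolvesInterpolation n F (f 0) ϑ ∧
        ϑ - faberSchauderCoeff (n + 1) f = w := by
  -- With this frequency, `sin (c * t) = 0` and `cos (c * t) = 1` at every grid point.
  set c : ℝ := 2 * Real.pi * 2 ^ (n + 1) with hc
  have hc0 : c ≠ 0 := by positivity
  have hcj : ∀ j : ℕ, c * ((j : ℝ) / 2 ^ (n + 1)) = j * (2 * Real.pi) := by
    intro j; rw [hc]; field_simp
  set g := faberSchauderSum 0 w with hg
  have hgc : Continuous g := continuous_faberSchauderSum 0 w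
  set φ : ℝ → ℝ := fun t => t - Real.sin (c * t) / c with hφ
  have hφd : ∀ t, HasDerivAt φ (1 - Real.cos (c * t)) t := by
    intro t
    have h₁ : HasDerivAt (fun t : ℝ => c * t) c t := by
      simpa using (hasDerivAt_id t).const_mul c
    have h₂ := (hasDerivAt_id t).sub (h₁.sin.div_const c)
    rwa [mul_div_cancel_right₀ _ hc0] at h₂
  have hφj : ∀ j : ℕ, φ ((j : ℝ) / 2 ^ (n + 1)) = (j : ℝ) / 2 ^ (n + 1) := by
    intro j
    have : Real.sin (j * (2 * Real.pi)) = 0 := by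
      have := Real.sin_nat_mul_pi (j * 2)
      push_cast at this
      rwa [mul_assoc] at this
    simp [hφ, hcj, this]
  refine ⟨fun t => ∫ s in (0 : ℝ)..(φ t), g s, fun t => g (φ t) * (1 - Real.cos (c * t)),
    ?_, fun t => ?_, w, ?_, ?_⟩
  · have : Continuous φ := by fun_prop
    fun_prop
  · exact (intervalIntegral.integral_hasDerivAt_right (hgc.intervalIntegrable _ _)
      (hgc.stronglyMeasurableAtFilter _ _) hgc.continuousAt).comp t (hφd t)
  · intro j _
    have h0 : φ 0 = 0 := by simpa using hφj 0
    simp only [hφj, h0, intervalIntegral.integral_same, mul_zero, Real.cos_zero, sub_self, zero_add]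
    rfl
  -- The factor `1 - cos (c * t)` makes `f` agree on the grid with the zero sum.
  · have hz : faberSchauderCoeff (n + 1) (fun t => g (φ t) * (1 - Real.cos (c * t))) =
        faberSchauderCoeff (n + 1) (faberSchauderSum 0 (0 : FSIndex (n + 1) → ℝ)) := by
      refine faberSchauderCoeff_congr fun j _ => ?_
      simp [hcj, Real.cos_nat_mul_two_pi, faberSchauderSum]
    rw [hz, faberSchauderCoeff_faberSchauderSum, sub_zero]

/-- The errors of the previous generations do not control those of the final generation. -/
theorem exists_finalGeneration_ge (n : ℕ) (C : ℝ) :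
    ∃ w : FSIndex (n + 1) → ℝ, ‖previousGenerations w‖ = 1 ∧ C ≤ ‖finalGeneration w‖ := by
  -- Value `1` at index `(-1, 0)`, `C` throughout generation `n`, and `0` in between; a single final
  -- entry already gives the bound.
  refine ⟨fun i => i.elim 1 fun p => if p.1 = Fin.last n then C else 0, ?_, ?_⟩
  · rw [EuclideanSpace.norm_eq, Fintype.sum_option]
    have : ∀ m : Fin n, m.castSucc ≠ Fin.last n := fun m => (Fin.castSucc_lt_last m).ne
    simp [previousGenerations, FSIndex.lift, this]
  · refine le_trans ?_ (PiLp.norm_apply_le _ (⟨0, by positivity⟩ : Fin (2 ^ n)))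
    simpa [finalGeneration] using le_abs_self C

theorem corollary2p6 (n : ℕ) (hn : 2 ≤ n) (ε : ℝ) (hε : 0 < ε) :
    ∃ F f : ℝ → ℝ,
      (ContinuousOn f (Icc 0 1) ∧ ∀ t ∈ Icc (0 : ℝ) 1, HasDerivWithinAt F (f t) (Icc 0 1) t) ∧
      ∃ ϑ : FSIndex (n + 1) → ℝ,
        (SolvesInterpolation n F (f 0) ϑ ∧
          ∀ ϑ' : FSIndex (n + 1) → ℝ, SolvesInterpolation n F (f 0) ϑ' → ϑ' = ϑ) ∧
        0 < ‖previousGenerations (ϑ - faberSchauderCoeff (n + 1) f)‖ ∧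
        ‖finalGeneration (ϑ - faberSchauderCoeff (n + 1) f)‖ ≥
          2 * (1 - ε) * √((2 : ℝ) ^ (2 * n + 2) / Real.pi ^ 2 - 3 / 4) *
            ‖previousGenerations (ϑ - faberSchauderCoeff (n + 1) f)‖ := by
  obtain ⟨w, hw, hC⟩ := exists_finalGeneration_ge n
    (2 * (1 - ε) * √((2 : ℝ) ^ (2 * n + 2) / Real.pi ^ 2 - 3 / 4))
  obtain ⟨F, f, hf, hF, ϑ, hϑ, herr⟩ := exists_interpolation_error_eq n w
  refine ⟨F, f, ⟨hf.continuousOn, fun t _ => (hF t).hasDerivWithinAt⟩, ϑ,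
    ⟨hϑ, fun ϑ' h' => hϑ.unique h'⟩, ?_, ?_⟩
  · rw [herr, hw]; exact one_pos
  · rw [herr, hw, mul_one]; exact hC
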